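/- Let $d\ge 0$ and $m\ge 1$ be integers, $\sigma>0$, $L\in\mathbb{R}$, and let $f:\mathbb{R}^d\to\mathbb{R}$ be a twice differentiable function with $\int_{\mathbb{R}^d}e^{-f(x)}\,dx<\infty$ and $$-L I\preccurlyeq\nabla^2 f(x)\preccurlyeq L I\qquad\text{for all }x\in\mathbb{R}^d .$$ Let $X$ be a random vector with density $p_X(x)=e^{-f(x)}/\int e^{-f}$, and let $Y_t=X+N_t$ for $t=1,\dots,m$, where $N_t\sim\mathcal{N}(0,\sigma^2 I)$ and $X,N_1,\dots,N_m$ are independent. Let $\mathbb{E}[X\mid Y_{1:m}]$ denote the mean of the conditional distribution of $X$ given $Y_{1:m}=(Y_1,\dots,Y_m)$, and let $\hat p_{\sigma,m}$ be the law of the random vector $\mathbb{E}[X\mid Y_{1:m}]$. Then the conditional distribution of $X$ given $Y_{1:m}$ almost surely has a finite first moment, so that this mean is well defined (no moment of $X$ itself is assumed), and $$W_2(p_X,\hat p_{\sigma,m})^2\le\frac{\sigma^2}{m}\,d+2dL\Bigl(\frac{\sigma^2}{m}\Bigr)^2 ,$$ where $W_2(\mu,\nu)=\bigl(\inf_\pi\int\|x-y\|^2\,d\pi(x,y)\bigr)^{1/2}\in[0,\infty]$,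 the infimum being over all couplings $\pi$ of $\mu$ and $\nu$. -/

import Mathlib

open MeasureTheory ProbabilityTheory
open scoped ENNReal Gradient

noncomputable section

/-- The probability measure on `ℝ^d` with Lebesgue density `e^{-f} / Z`, `Z = ∫ e^{-f}`. -/
def gibbsMeasure {d : ℕ} (f : EuclideanSpace ℝ (Fin d) → ℝ) :
    Measure (EuclideanSpace ℝ (Fin d)) :=
  volume.withDensity fun x ↦ ENNReal.ofReal (Real.exp (-f x) / ∫ z, Real.exp (-f z))

/-- The Hessian of `f` at `x`, as the derivative of the gradient. -/
def hessian {d : ℕ} (f : EuclideanSpace ℝ (Fin d) → ℝ) (x : EuclideanSpace ℝ (Fin d)) :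
    EuclideanSpace ℝ (Fin d) →L[ℝ] EuclideanSpace ℝ (Fin d) :=
  fderiv ℝ (∇ f) x

/-- `π` is a coupling of `μ` and `ν`: its marginals are `μ` and `ν`. -/
def IsCoupling {E : Type*} [MeasurableSpace E] (μ ν : Measure E) (π : Measure (E × E)) : Prop :=
  π.map Prod.fst = μ ∧ π.map Prod.snd = ν

/-- The 2-Wasserstein distance, with values in `[0, ∞]`: the square root of the infimum of the
quadratic transport cost over all couplings. -/
def wasserstein2 {E : Type*} [PseudoEMetricSpace E] [MeasurableSpace E] (μ ν : Measure E) :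
    ℝ≥0∞ :=
  (⨅ (π : Measure (E × E)) (_ : IsCoupling μ ν π), ∫⁻ z, edist z.1 z.2 ^ 2 ∂π) ^ (1 / 2 : ℝ)

/-- The empirical Bayes estimate `E[X | Y]` as a random variable: the mean of the regular
conditional distribution of `X` given `Y`. For integrable `X` it is almost surely equal to the
conditional expectation `P[X | σ(Y)]`; it also makes sense when `X` has no first moment, as long
as the conditional distribution has one. -/
def bayesEstimate {Ω F : Type*} [MeasurableSpace Ω] [MeasurableSpace F] {d : ℕ}
    (X : Ω → EuclideanSpace ℝ (Fin d)) (Y : Ω → F) (P : Measure Ω) [IsFiniteMeasure P] :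
    Ω → EuclideanSpace ℝ (Fin d) :=
  fun ω ↦ ∫ x, x ∂(condDistrib X Y P (Y ω))

end

/-! The pair (X, E[X | Y]) is itself a coupling, so W₂² is at most the mean squared error of the
Bayes estimate (`wasserstein2_map_sq_le`). That error is minimal among all measurable estimators
(`lintegral_edist_bayesEstimate_sq_le`), hence at most that of the sample mean, whose error is the
averaged noise, with second moment σ²d/m (`lintegral_enorm_average_gaussian_sq`). So the first term
of the bound already suffices; the Hessian bounds serve only to make the second term nonnegative.
The same finite error gives the posterior a second moment almost surely, with no moment of X needed.
-/

open scoped RealInnerProductSpace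

section SecondMoment

/-- A finite second moment about some point gives square integrability of the identity. -/
lemma memLp_id_two_of_lintegral_edist_sq_ne_top {E : Type*} [NormedAddCommGroup E]
    [MeasurableSpace E] [BorelSpace E] [SecondCountableTopology E] {ρ : Measure E}
    [IsFiniteMeasure ρ] {c : E} (h : ∫⁻ x, edist x c ^ 2 ∂ρ ≠ ∞) :
    MemLp (fun x : E ↦ x) 2 ρ := by
  have hc : MemLp (fun x : E ↦ x - c) 2 ρ := by
    refine ⟨by fun_prop, ?_⟩
    rw [eLpNorm_lt_top_iff_lintegral_rpow_enorm_lt_top (by simp) (by simp)]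
    simpa [edist_eq_enorm_sub] using h.lt_top
  exact (hc.add (memLp_const c)).congr_norm (by fun_prop) (ae_of_all _ fun x ↦ by simp)

variable {E : Type*} [NormedAddCommGroup E] [InnerProductSpace ℝ E] [CompleteSpace E]
  [MeasurableSpace E] [BorelSpace E] [SecondCountableTopology E]

/-- The mean of a probability measure minimizes the mean squared distance. -/
lemma lintegral_edist_integral_sq_le (ρ : Measure E) [IsProbabilityMeasure ρ] (c : E) :
    ∫⁻ x, edist x (∫ y, y ∂ρ) ^ 2 ∂ρ ≤ ∫⁻ x, edist x c ^ 2 ∂ρ := by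
  -- Outside this trivial case the identity is integrable, so the mean is genuine and not the
  -- Bochner default 0.
  by_cases h : ∫⁻ x, edist x c ^ 2 ∂ρ = ∞
  · simp [h]
  have hid := memLp_id_two_of_lintegral_edist_sq_ne_top h
  have hint : Integrable (fun x : E ↦ x) ρ := hid.integrable (by norm_num)
  set a := ∫ y, y ∂ρ with ha
  have hsq (b : E) : Integrable (fun x ↦ ‖x - b‖ ^ 2) ρ :=
    (hid.sub (memLp_const b)).integrable_norm_pow (by norm_num)
  have hof (b : E) : ∫⁻ x, edist x b ^ 2 ∂ρ = ENNReal.ofReal (∫ x, ‖x - b‖ ^ 2 ∂ρ) := by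
    rw [ofReal_integral_eq_lintegral_ofReal (hsq b) (ae_of_all _ fun x ↦ by positivity)]
    refine lintegral_congr fun x ↦ ?_
    rw [edist_dist, dist_eq_norm, ENNReal.ofReal_pow (norm_nonneg _)]
  rw [hof, hof]
  refine ENNReal.ofReal_le_ofReal ?_
  have hzero : ∫ x, ⟪a - c, x - a⟫ ∂ρ = 0 := by
    have h0 := integral_inner (𝕜 := ℝ) (hint.sub (integrable_const a)) (a - c)
    simp only [Pi.sub_apply] at h0
    rw [h0, integral_sub hint (integrable_const a)]
    simp [← ha]
  have hin : Integrable (fun x ↦ ⟪a - c, x - a⟫) ρ :=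
    (hint.sub (integrable_const a)).const_inner _
  -- Adding the cross term, which has mean zero, makes the inequality pointwise: the new integrand
  -- is ‖x - c‖² - ‖a - c‖².
  calc ∫ x, ‖x - a‖ ^ 2 ∂ρ = ∫ x, (‖x - a‖ ^ 2 + 2 * ⟪a - c, x - a⟫) ∂ρ := by
        rw [integral_add (hsq a) (hin.const_mul 2), integral_const_mul, hzero]; simp
    _ ≤ ∫ x, ‖x - c‖ ^ 2 ∂ρ := by
        refine integral_mono ((hsq a).add (hin.const_mul 2)) (hsq c) fun x ↦ ?_
        have h1 : x - c = (x - a) + (a - c) := by abel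
        simp only [h1, norm_add_sq_real, real_inner_comm (x - a) (a - c)]
        nlinarith [sq_nonneg ‖a - c‖, real_inner_comm (x - a) (a - c)]

end SecondMoment

section Bayes

variable {Ω F : Type*} [MeasurableSpace Ω] [MeasurableSpace F] {d : ℕ}
  {X : Ω → EuclideanSpace ℝ (Fin d)} {Y : Ω → F} {P : Measure Ω} [IsProbabilityMeasure P]

/-- Disintegration of the joint law of `(Y, X)` along `condDistrib`. -/
lemma lintegral_condDistrib (hX : AEMeasurable X P) (hY : AEMeasurable Y P)
    {g : F × EuclideanSpace ℝ (Fin d) → ℝ≥0∞} (hg : Measurable g) :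
    ∫⁻ y, ∫⁻ x, g (y, x) ∂(condDistrib X Y P y) ∂(P.map Y) = ∫⁻ ω, g (Y ω, X ω) ∂P := by
  rw [← Measure.lintegral_compProd hg, compProd_map_condDistrib hX,
    lintegral_map' hg.aemeasurable (hY.prodMk hX)]

lemma measurable_integral_condDistrib_id :
    Measurable fun y ↦ ∫ x, x ∂(condDistrib X Y P y) :=
  (StronglyMeasurable.integral_kernel (κ := condDistrib X Y P)
    (f := fun x : EuclideanSpace ℝ (Fin d) ↦ x) stronglyMeasurable_id).measurable

lemma aemeasurable_bayesEstimate (hY : AEMeasurable Y P) :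
    AEMeasurable (bayesEstimate X Y P) P :=
  measurable_integral_condDistrib_id.comp_aemeasurable hY

/-- If some estimator of `X` from `Y` has finite mean squared error, then the conditional
distribution of `X` given `Y` almost surely has a first moment. -/
lemma ae_integrable_condDistrib_of_estimator (hX : AEMeasurable X P) (hY : AEMeasurable Y P)
    {g : F → EuclideanSpace ℝ (Fin d)} (hg : Measurable g)
    (h : ∫⁻ ω, edist (X ω) (g (Y ω)) ^ 2 ∂P ≠ ∞) :
    ∀ᵐ ω ∂P, Integrable (fun x ↦ x) (condDistrib X Y P (Y ω)) := by
  have hm : Measurable fun p : F × EuclideanSpace ℝ (Fin d) ↦ edist p.2 (g p.1) ^ 2 := by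
    fun_prop
  rw [← lintegral_condDistrib hX hY hm] at h
  refine ae_of_ae_map hY (p := fun y ↦ Integrable (fun x ↦ x) (condDistrib X Y P y)) ?_
  filter_upwards [ae_lt_top hm.lintegral_kernel_prod_right' h] with y hy
  exact (memLp_id_two_of_lintegral_edist_sq_ne_top hy.ne).integrable (by norm_num)

/-- The Bayes estimate has the smallest mean squared error among all estimators. -/
lemma lintegral_edist_bayesEstimate_sq_le (hX : AEMeasurable X P) (hY : AEMeasurable Y P)
    {g : F → EuclideanSpace ℝ (Fin d)} (hg : Measurable g) :
    ∫⁻ ω, edist (X ω) (bayesEstimate X Y P ω) ^ 2 ∂P ≤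
      ∫⁻ ω, edist (X ω) (g (Y ω)) ^ 2 ∂P := by
  have hb := measurable_integral_condDistrib_id (X := X) (Y := Y) (P := P)
  have h1 : ∫⁻ y, ∫⁻ x, edist x (∫ x, x ∂(condDistrib X Y P y)) ^ 2 ∂(condDistrib X Y P y)
      ∂(P.map Y) = ∫⁻ ω, edist (X ω) (bayesEstimate X Y P ω) ^ 2 ∂P :=
    lintegral_condDistrib hX hY
      (g := fun p ↦ edist p.2 (∫ x, x ∂(condDistrib X Y P p.1)) ^ 2)
      ((measurable_snd.edist (hb.comp measurable_fst)).pow_const 2)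
  have h2 : ∫⁻ y, ∫⁻ x, edist x (g y) ^ 2 ∂(condDistrib X Y P y) ∂(P.map Y) =
      ∫⁻ ω, edist (X ω) (g (Y ω)) ^ 2 ∂P :=
    lintegral_condDistrib hX hY (g := fun p ↦ edist p.2 (g p.1) ^ 2)
      ((measurable_snd.edist (hg.comp measurable_fst)).pow_const 2)
  rw [← h1, ← h2]
  exact lintegral_mono fun y ↦ lintegral_edist_integral_sq_le (condDistrib X Y P y) (g y)

end Bayes

/-- Any two random variables with the prescribed laws bound the Wasserstein distance. -/
lemma wasserstein2_map_sq_le {Ω E : Type*} [MeasurableSpace Ω] [PseudoEMetricSpace E]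
    [MeasurableSpace E] [OpensMeasurableSpace E] [SecondCountableTopology E]
    {P : Measure Ω} {U V : Ω → E} (hU : AEMeasurable U P) (hV : AEMeasurable V P) :
    wasserstein2 (P.map U) (P.map V) ^ 2 ≤ ∫⁻ ω, edist (U ω) (V ω) ^ 2 ∂P := by
  rw [wasserstein2, ← ENNReal.rpow_natCast, ← ENNReal.rpow_mul]
  norm_num only [Nat.cast_ofNat, ENNReal.rpow_one]
  have hc : IsCoupling (P.map U) (P.map V) (P.map fun ω ↦ (U ω, V ω)) := by
    constructor
    · rw [AEMeasurable.map_map_of_aemeasurable measurable_fst.aemeasurable (hU.prodMk hV)]; rfl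
    · rw [AEMeasurable.map_map_of_aemeasurable measurable_snd.aemeasurable (hU.prodMk hV)]; rfl
  refine (iInf₂_le _ hc).trans_eq ?_
  exact lintegral_map' (by fun_prop) (hU.prodMk hV)

section Noise

variable {Ω : Type*} [MeasurableSpace Ω] {P : Measure Ω} [IsProbabilityMeasure P] {d m : ℕ}
  {σ : ℝ} {N : Fin m → Ω → EuclideanSpace ℝ (Fin d)}

/-- The second moment of the average of `m` independent `𝒩(0, σ² I)` vectors. -/
lemma lintegral_enorm_average_gaussian_sq (hm : 1 ≤ m)
    (hN : ∀ t, HasLaw (N t)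
      (multivariateGaussian 0 (σ ^ 2 • (1 : Matrix (Fin d) (Fin d) ℝ))) P)
    (hN_indep : iIndepFun N P) :
    ∫⁻ ω, ‖(m : ℝ)⁻¹ • ∑ t, N t ω‖ₑ ^ 2 ∂P = ENNReal.ofReal (σ ^ 2 / m * d) := by
  have hm0 : (m : ℝ) ≠ 0 := by positivity
  have hS : (σ ^ 2 • (1 : Matrix (Fin d) (Fin d) ℝ)).PosSemidef :=
    Matrix.PosSemidef.one.smul (sq_nonneg σ)
  have hlaw (t : Fin m) (i : Fin d) :
      HasLaw (fun ω ↦ N t ω i) (gaussianReal 0 (σ ^ 2).toNNReal) P := by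
    simpa using (measurePreserving_eval_multivariateGaussian hS (i := i)).hasLaw.fun_comp (hN t)
  have hL2 (t : Fin m) (i : Fin d) : MemLp (fun ω ↦ N t ω i) 2 P := by
    have h := memLp_id_gaussianReal (μ := 0) (v := (σ ^ 2).toNNReal) 2
    rw [← (hlaw t i).map_eq] at h
    exact h.comp_of_map (hlaw t i).aemeasurable
  have hmean (t : Fin m) (i : Fin d) : ∫ ω, N t ω i ∂P = 0 := by
    rw [(hlaw t i).integral_eq, integral_id_gaussianReal]
  have hvar (t : Fin m) (i : Fin d) : Var[fun ω ↦ N t ω i; P] = σ ^ 2 := by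
    rw [(hlaw t i).variance_eq]
    simp [variance_id_gaussianReal, sq_nonneg]
  have hsumL2 (i : Fin d) : MemLp (∑ t, fun ω ↦ N t ω i) 2 P :=
    memLp_finsetSum' _ fun t _ ↦ hL2 t i
  have hsumvar (i : Fin d) : ∫ ω, (∑ t, N t ω i) ^ 2 ∂P = m * σ ^ 2 := by
    -- Independence is needed only across `t` for fixed `i`: the squared norm splits as a sum over
    -- coordinates.
    have h := IndepFun.variance_sum (μ := P) (s := Finset.univ)
      (X := fun t ω ↦ N t ω i) (fun t _ ↦ hL2 t i) fun s _ t _ hst ↦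
        (hN_indep.indepFun hst).comp (φ := fun x : EuclideanSpace ℝ (Fin d) ↦ x i)
          (ψ := fun x : EuclideanSpace ℝ (Fin d) ↦ x i)
          (by fun_prop) (by fun_prop)
    rw [variance_of_integral_eq_zero (hsumL2 i).aemeasurable] at h
    · simpa [hvar, Finset.sum_apply] using h
    · simp_rw [Finset.sum_apply]
      rw [integral_finsetSum _ fun t _ ↦ (hL2 t i).integrable (by norm_num)]
      simp [hmean]
  have hsq (i : Fin d) : Integrable (fun ω ↦ (∑ t, N t ω i) ^ 2) P := by
    simpa using (hsumL2 i).integrable_sq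
  have hpt (ω : Ω) : ‖(m : ℝ)⁻¹ • ∑ t, N t ω‖ ^ 2 =
      (m : ℝ)⁻¹ ^ 2 * ∑ i, (∑ t, N t ω i) ^ 2 := by
    rw [norm_smul, mul_pow, EuclideanSpace.real_norm_sq_eq]
    simp
  have hint : Integrable (fun ω ↦ ‖(m : ℝ)⁻¹ • ∑ t, N t ω‖ ^ 2) P := by
    simp_rw [hpt]
    exact (integrable_finsetSum _ fun i _ ↦ hsq i).const_mul _
  calc ∫⁻ ω, ‖(m : ℝ)⁻¹ • ∑ t, N t ω‖ₑ ^ 2 ∂P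
      = ∫⁻ ω, ENNReal.ofReal (‖(m : ℝ)⁻¹ • ∑ t, N t ω‖ ^ 2) ∂P :=
        lintegral_congr fun ω ↦ by
          rw [ENNReal.ofReal_pow (norm_nonneg _), ofReal_norm]
    _ = ENNReal.ofReal (σ ^ 2 / m * d) := by
        rw [← ofReal_integral_eq_lintegral_ofReal hint (ae_of_all _ fun ω ↦ by positivity)]
        simp_rw [hpt]
        rw [integral_const_mul, integral_finsetSum _ fun i _ ↦ hsq i]
        simp only [hsumvar, Finset.sum_const, Finset.card_univ, Fintype.card_fin, nsmul_eq_mul]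
        congr 1
        field_simp

end Noise

/-- Two-sided bounds `-L I ≼ A ≼ L I` in positive dimension force `0 ≤ L`. -/
lemma nonneg_of_neg_smul_id_le_of_le_smul_id {E : Type*} [NormedAddCommGroup E]
    [InnerProductSpace ℝ E] [Nontrivial E] {L : ℝ} {A : E →L[ℝ] E}
    (h₁ : -(L • ContinuousLinearMap.id ℝ E) ≤ A) (h₂ : A ≤ L • ContinuousLinearMap.id ℝ E) :
    0 ≤ L := by
  obtain ⟨v, hv⟩ := exists_ne (0 : E)
  have h := ((ContinuousLinearMap.le_def _ _).1 (h₁.trans h₂)).inner_nonneg_left v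
  have hv' : 0 < ⟪v, v⟫ := real_inner_self_pos.2 hv
  simp only [sub_neg_eq_add, add_apply, smul_apply,
    ContinuousLinearMap.id_apply, inner_add_left, real_inner_smul_left] at h
  by_contra! hL
  nlinarith

theorem mainTheorem3 {d m : ℕ} (hm : 1 ≤ m) {σ : ℝ} (hσ : 0 < σ) (L : ℝ)
    (f : EuclideanSpace ℝ (Fin d) → ℝ)
    (hf : Differentiable ℝ f) (hf' : Differentiable ℝ (∇ f))
    (hf_int : Integrable (fun x ↦ Real.exp (-f x)))
    (hHess : ∀ x, -(L • ContinuousLinearMap.id ℝ (EuclideanSpace ℝ (Fin d))) ≤ hessian f x ∧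
      hessian f x ≤ L • ContinuousLinearMap.id ℝ (EuclideanSpace ℝ (Fin d)))
    {Ω : Type*} [MeasurableSpace Ω] (P : Measure Ω) [IsProbabilityMeasure P]
    (X : Ω → EuclideanSpace ℝ (Fin d)) (N : Fin m → Ω → EuclideanSpace ℝ (Fin d))
    (hX : HasLaw X (gibbsMeasure f) P)
    (hN : ∀ t, HasLaw (N t)
      (multivariateGaussian 0 (σ ^ 2 • (1 : Matrix (Fin d) (Fin d) ℝ))) P)
    (hN_indep : iIndepFun N P) (hXN_indep : IndepFun X (fun ω t ↦ N t ω) P)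
    (Y : Ω → Fin m → EuclideanSpace ℝ (Fin d)) (hY : ∀ ω t, Y ω t = X ω + N t ω) :
    (∀ᵐ ω ∂P, Integrable (fun x ↦ x) (condDistrib X Y P (Y ω))) ∧
      wasserstein2 (gibbsMeasure f) (P.map (bayesEstimate X Y P)) ^ 2 ≤
        ENNReal.ofReal (σ ^ 2 / m * d + 2 * d * L * (σ ^ 2 / m) ^ 2) := by
  have hXm : AEMeasurable X P := hX.aemeasurable
  have hYm : AEMeasurable Y P := by
    refine aemeasurable_pi_lambda _ fun t ↦ ?_
    simp_rw [hY]
    exact hXm.add (hN t).aemeasurable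
  have hm0 : (m : ℝ) ≠ 0 := by positivity
  -- The competitor is the sample mean: X cancels in its error, leaving only noise.
  let g : (Fin m → EuclideanSpace ℝ (Fin d)) → EuclideanSpace ℝ (Fin d) :=
    fun y ↦ (m : ℝ)⁻¹ • ∑ t, y t
  have hg : Measurable g := by fun_prop
  have herr : ∫⁻ ω, edist (X ω) (g (Y ω)) ^ 2 ∂P = ENNReal.ofReal (σ ^ 2 / m * d) := by
    rw [← lintegral_enorm_average_gaussian_sq hm hN hN_indep]
    refine lintegral_congr fun ω ↦ ?_
    have hgY : g (Y ω) = X ω + (m : ℝ)⁻¹ • ∑ t, N t ω := by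
      simp [g, hY, Finset.sum_add_distrib, ← Nat.cast_smul_eq_nsmul ℝ, smul_smul, hm0]
    rw [hgY, edist_comm, edist_eq_enorm_sub, add_sub_cancel_left]
  refine ⟨ae_integrable_condDistrib_of_estimator hXm hYm hg (herr ▸ ENNReal.ofReal_ne_top), ?_⟩
  -- For d = 0 the Hessian bounds say nothing about the sign of L, but the factor d vanishes.
  have hdL : 0 ≤ d * L := by
    rcases Nat.eq_zero_or_pos d with rfl | hd
    · simp
    · have : NeZero d := ⟨hd.ne'⟩
      exact mul_nonneg d.cast_nonneg
        (nonneg_of_neg_smul_id_le_of_le_smul_id (hHess 0).1 (hHess 0).2)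
  calc wasserstein2 (gibbsMeasure f) (P.map (bayesEstimate X Y P)) ^ 2
      ≤ ∫⁻ ω, edist (X ω) (bayesEstimate X Y P ω) ^ 2 ∂P := by
        rw [← hX.map_eq]
        exact wasserstein2_map_sq_le hXm (aemeasurable_bayesEstimate hYm)
    _ ≤ ∫⁻ ω, edist (X ω) (g (Y ω)) ^ 2 ∂P := lintegral_edist_bayesEstimate_sq_le hXm hYm hg
    _ = ENNReal.ofReal (σ ^ 2 / m * d) := herr
    _ ≤ ENNReal.ofReal (σ ^ 2 / m * d + 2 * d * L * (σ ^ 2 / m) ^ 2) := by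
        refine ENNReal.ofReal_le_ofReal (le_add_of_nonneg_right ?_)
        rw [mul_assoc 2]
        positivity
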